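/- **Theorem (Addendum).** Let $\mathbb D=\{z\in\mathbb C:|z|<1\}$, let $n$ be a positive integer, and let $f:\mathbb D\to\mathbb C$ be analytic and exactly $n$-to-one as a map of $\mathbb D$ onto $f(\mathbb D)$, counting multiplicity; that is, for every $w\in f(\mathbb D)$ the set $\{z\in\mathbb D: f(z)=w\}$ is finite and the multiplicities of its points as zeros of $f-w$ add up to $n$. Then there are a finite Blaschke product of order $n$, $$\phi(z)=\lambda\prod_{k=1}^n\frac{z-\alpha_k}{1-\overline{\alpha_k}\,z},\qquad |\lambda|=1,\quad \alpha_1,\dots,\alpha_n\in\mathbb D,$$ and a one-to-one analytic function $\widetilde f:\mathbb D\to\mathbb C$ such that $f=\widetilde f\circ\phi$ on $\mathbb D$. -/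

import Mathlib

/-- `f` takes each of its values on `U` exactly `n` times in `U`, counted with multiplicity:
for every `w ∈ f '' U` the fibre of `w` in `U` is finite, and the orders of vanishing of `f - w`
at the points of the fibre add up to `n`. -/
def IsExactlyToOneOn (n : ℕ) (f : ℂ → ℂ) (U : Set ℂ) : Prop :=
  ∀ w ∈ f '' U, ∃ s : Finset ℂ, (s : Set ℂ) = {z | z ∈ U ∧ f z = w} ∧
    ∑ z ∈ s, analyticOrderAt (fun ζ => f ζ - w) z = (n : ℕ∞)

/-- On the open unit disk, `φ` is a finite Blaschke product of order `n`. -/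
def IsFiniteBlaschkeProduct (n : ℕ) (φ : ℂ → ℂ) : Prop :=
  ∃ (c : ℂ) (α : Fin n → ℂ), ‖c‖ = 1 ∧ (∀ k, ‖α k‖ < 1) ∧
    ∀ z ∈ Metric.ball (0 : ℂ) 1,
      φ z = c * ∏ k, (z - α k) / (1 - (starRingEnd ℂ) (α k) * z)

open Metric Filter Topology

/-! Let `B` be the Blaschke product whose n zeros form one fibre of `f`, over w₀ say. The trace of
an analytic function, its sum over the points of a fibre, is an argument-principle integral and so
depends analytically on the value (`exists_differentiableOn_trace`).

Write B = (f - w₀) exp L and let T be the trace of L along f. Off the zeros of B, exp(nL - T ∘ f) at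
z is B(z)^n divided by the product of B over the fibre through z. Near the unit circle the whole
fibre is near the circle (`exists_forall_norm_lt_of_factorsAt`), so this quotient has modulus close
to 1, and the maximum principle makes nL - T ∘ f constant. Hence B = Φ ∘ f with Φ analytic
(`exists_blaschke_eq_comp`).

Conversely, if B took a value u at two points where f differs, Φ - u would have two zeros, each with
n preimages under f, but B takes u only n times (`eq_of_blaschke_eq`). So f is constant on the
fibres of B and equals 1/n times its own trace along B, which gives f = g ∘ B with g analytic. Since
Φ ∘ g is the identity of the disk, g is injective. -/

/-! ### Factoring out the zeros of a fibre -/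

/-- On the unit disk, `f - w` is the product of the linear factors `z - a k`, with `a k` in the
disk, and of a nonvanishing analytic function. -/
def FactorsAt {ι : Type*} [Fintype ι] (f : ℂ → ℂ) (w : ℂ) (a : ι → ℂ) : Prop :=
  (∀ k, ‖a k‖ < 1) ∧ ∃ h : ℂ → ℂ, DifferentiableOn ℂ h (ball 0 1) ∧
    (∀ z ∈ ball (0 : ℂ) 1, h z ≠ 0) ∧ ∀ z ∈ ball (0 : ℂ) 1, f z - w = (∏ k, (z - a k)) * h z

theorem FactorsAt.eq_iff {ι : Type*} [Fintype ι] {f : ℂ → ℂ} {w : ℂ} {a : ι → ℂ}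
    (ha : FactorsAt f w a) {z : ℂ} (hz : z ∈ ball (0 : ℂ) 1) : f z = w ↔ ∃ k, z = a k := by
  obtain ⟨-, h, -, hh, e⟩ := ha
  rw [← sub_eq_zero, e z hz, mul_eq_zero, or_iff_left (hh z hz), Finset.prod_eq_zero_iff]
  simp [sub_eq_zero]

theorem FactorsAt.apply_eq {ι : Type*} [Fintype ι] {f : ℂ → ℂ} {w : ℂ} {a : ι → ℂ}
    (ha : FactorsAt f w a) (k : ι) : f (a k) = w :=
  (ha.eq_iff (by simpa using ha.1 k)).2 ⟨k, rfl⟩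

/-- Induction on n, dividing out one zero at a time with `dslope`. The set `s` is only required to
contain the zeros, so it can stay fixed when p ceases to be one. -/
theorem exists_factorization_of_sum_analyticOrderAt {U : Set ℂ} (hU : IsOpen U) (s : Finset ℂ)
    (hs : (s : Set ℂ) ⊆ U) (n : ℕ) (F : ℂ → ℂ) (hF : DifferentiableOn ℂ F U)
    (hz : ∀ z ∈ U, F z = 0 → z ∈ s) (hsum : ∑ z ∈ s, analyticOrderAt F z = (n : ℕ∞)) :
    ∃ a : Fin n → ℂ, (∀ k, a k ∈ U) ∧ ∃ h : ℂ → ℂ, DifferentiableOn ℂ h U ∧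
      (∀ z ∈ U, h z ≠ 0) ∧ ∀ z ∈ U, F z = (∏ k, (z - a k)) * h z := by
  induction n generalizing F with
  | zero =>
    refine ⟨Fin.elim0, fun k => k.elim0, F, hF, fun z hzU h0 => ?_, by simp⟩
    have h1 := (Finset.sum_eq_zero_iff.1 hsum) z (hz z hzU h0)
    exact ((hF.analyticAt (hU.mem_nhds hzU)).analyticOrderAt_ne_zero.2 h0) h1
  | succ n ih =>
    obtain ⟨p, hp, hp0⟩ : ∃ p ∈ s, analyticOrderAt F p ≠ 0 := by
      by_contra! hc
      rw [Finset.sum_eq_zero hc] at hsum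
      norm_cast at hsum
    have hFp := apply_eq_zero_of_analyticOrderAt_ne_zero hp0
    have hpU := hs hp
    have hG : DifferentiableOn ℂ (dslope F p) U :=
      (Complex.differentiableOn_dslope (hU.mem_nhds hpU)).2 hF
    have hFG : F = (fun z => z - p) * dslope F p := by
      funext z
      have := sub_smul_dslope F p z
      simp only [smul_eq_mul, hFp, sub_zero] at this
      simp [this]
    have hord : ∀ z ∈ s, analyticOrderAt F z =
        (if z = p then 1 else 0) + analyticOrderAt (dslope F p) z := by
      intro z hzs
      have h1 : AnalyticAt ℂ (fun z => z - p) z := by fun_prop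
      conv_lhs => rw [hFG]
      rw [analyticOrderAt_mul h1 (hG.analyticAt (hU.mem_nhds (hs hzs)))]
      congr 1
      split_ifs with hzp
      · subst hzp
        have : (1 : ℕ∞) = ((1 : ℕ) : ℕ∞) := rfl
        rw [this, h1.analyticOrderAt_eq_natCast]
        exact ⟨fun _ => 1, analyticAt_const, one_ne_zero, by simp⟩
      · rw [h1.analyticOrderAt_eq_zero]
        exact sub_ne_zero.2 hzp
    rw [Finset.sum_congr rfl hord, Finset.sum_add_distrib, Finset.sum_ite_eq' s p, if_pos hp,
      Nat.cast_succ, add_comm] at hsum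
    have hsum' := (ENat.add_left_injective_of_ne_top ENat.one_ne_top) hsum
    obtain ⟨a, haU, h, hh, hh0, he⟩ := ih (dslope F p) hG
      (fun z hzU h0 => hz z hzU (by rw [hFG]; simp [h0])) hsum'
    refine ⟨Fin.cons p a, fun k => ?_, h, hh, hh0, fun z hzU => ?_⟩
    · refine Fin.cases ?_ (fun k => ?_) k
      · simpa using hpU
      · simpa using haU k
    · rw [hFG, Fin.prod_univ_succ]
      simp [he z hzU, mul_assoc]

theorem IsExactlyToOneOn.exists_factorsAt {n : ℕ} {f : ℂ → ℂ}
    (hf : DifferentiableOn ℂ f (ball 0 1)) (hn : IsExactlyToOneOn n f (ball 0 1)) {w : ℂ}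
    (hw : w ∈ f '' ball 0 1) : ∃ a : Fin n → ℂ, FactorsAt f w a := by
  obtain ⟨s, hs, hsum⟩ := hn w hw
  have hmem : ∀ z, z ∈ s ↔ z ∈ ball (0 : ℂ) 1 ∧ f z = w := fun z => by
    rw [← Finset.mem_coe, hs]; rfl
  obtain ⟨a, ha, h⟩ := exists_factorization_of_sum_analyticOrderAt isOpen_ball s
    (fun z hz => ((hmem z).1 hz).1) n (fun ζ => f ζ - w) (hf.sub_const w)
    (fun z hz h0 => (hmem z).2 ⟨hz, sub_eq_zero.1 h0⟩) hsum
  exact ⟨a, fun k => by simpa using ha k, h⟩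

/-! ### The argument principle and its dependence on the value -/

/-- The generalized argument principle on a disk for a function in factored form. -/
theorem FactorsAt.circleIntegral_eq {ι : Type*} [Fintype ι] {f L : ℂ → ℂ} {w : ℂ} {a : ι → ℂ}
    (ha : FactorsAt f w a) (hL : DifferentiableOn ℂ L (ball 0 1)) {r : ℝ} (hr0 : 0 < r)
    (hr1 : r < 1) (har : ∀ k, ‖a k‖ ≠ r) :
    (∮ z in C(0, r), L z * deriv f z / (f z - w)) =
      2 * Real.pi * Complex.I * ∑ k, if ‖a k‖ < r then L (a k) else 0 := by
  obtain ⟨-, h, hh, hh0, he⟩ := ha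
  have hsub : closedBall (0 : ℂ) r ⊆ ball 0 1 := closedBall_subset_ball hr1
  have hsph : sphere (0 : ℂ) r ⊆ closedBall 0 r := sphere_subset_closedBall
  have hne : ∀ z ∈ sphere (0 : ℂ) r, ∀ k, z - a k ≠ 0 := by
    intro z hz k h0
    apply har k
    rw [← sub_eq_zero.1 h0]
    simpa using hz
  have hdiv : DifferentiableOn ℂ (fun z => L z * (deriv h z / h z)) (ball 0 1) :=
    hL.mul ((hh.deriv isOpen_ball).div hh hh0)
  have hcong : Set.EqOn (fun z => L z * deriv f z / (f z - w))
      (fun z => (∑ k, (z - a k)⁻¹ • L z) + L z * (deriv h z / h z)) (sphere 0 r) := by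
    intro z hz
    have hzb := hsub (hsph hz)
    have hnb := isOpen_ball.mem_nhds hzb
    have e1 : logDeriv (fun z => f z - w) z = logDeriv (fun z => (∏ k, (z - a k)) * h z) z :=
      by
        have e0 : (fun z => f z - w) =ᶠ[𝓝 z] fun z => (∏ k, (z - a k)) * h z := by
          filter_upwards [hnb] with y hy using he y hy
        rw [logDeriv_apply, logDeriv_apply, e0.deriv_eq, e0.eq_of_nhds]
    have e2 : logDeriv (fun z => f z - w) z = deriv f z / (f z - w) := by
      simp [logDeriv_apply]
    rw [logDeriv_mul (f := fun z => ∏ k, (z - a k)) (g := h) z (Finset.prod_ne_zero_iff.2 fun k _ => hne z hz k) (hh0 z hzb)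
      (by fun_prop) (hh.differentiableAt hnb), e2,
      logDeriv_prod (f := fun k z => z - a k) (fun k _ => hne z hz k) (fun k _ => by fun_prop)] at e1
    simp only [mul_div_assoc, e1, mul_add, Finset.mul_sum, smul_eq_mul, logDeriv_apply]
    congr 1
    refine Finset.sum_congr rfl fun k _ => ?_
    simp [mul_comm]
  have hLc : ContinuousOn L (sphere 0 r) := hL.continuousOn.mono (hsph.trans hsub)
  have hi : ∀ k, ContinuousOn (fun z => (z - a k)⁻¹ • L z) (sphere 0 r) := fun k =>
    ContinuousOn.smul (ContinuousOn.inv₀ (by fun_prop) fun z hz => hne z hz k) hLc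
  rw [circleIntegral.integral_congr hr0.le hcong, circleIntegral.integral_add
    (ContinuousOn.circleIntegrable hr0.le (continuousOn_finsetSum _ fun k _ => hi k))
    (ContinuousOn.circleIntegrable hr0.le (hdiv.continuousOn.mono (hsph.trans hsub))),
    circleIntegral.integral_fun_sum (fun k _ => (hi k).circleIntegrable hr0.le)]
  have h2 : (∮ z in C(0, r), L z * (deriv h z / h z)) = 0 :=
    (hdiv.mono (by rwa [closure_ball _ hr0.ne'])).diffContOnCl.circleIntegral_eq_zero hr0.le
  rw [h2, add_zero, Finset.mul_sum]
  refine Finset.sum_congr rfl fun k _ => ?_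
  split_ifs with hk
  · have := (hL.mono hsub).circleIntegral_sub_inv_smul (w := a k) (by simpa using hk)
    simpa using this
  · have hak : r < ‖a k‖ := lt_of_le_of_ne (not_lt.1 hk) (har k).symm
    have hd : DifferentiableOn ℂ (fun z => (z - a k)⁻¹ • L z) (closedBall 0 r) := by
      refine DifferentiableOn.smul (DifferentiableOn.fun_inv (differentiableOn_id.sub_const _)
        fun z hz h0 => ?_) (hL.mono hsub)
      rw [← sub_eq_zero.1 h0] at hak
      exact hak.not_ge (by simpa using hz)
    rw [mul_zero]
    rw [← closure_ball _ hr0.ne'] at hd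
    exact hd.diffContOnCl.circleIntegral_eq_zero hr0.le

theorem differentiableAt_circleIntegral_div_sub {φ f : ℂ → ℂ} {r : ℝ} (hr : 0 ≤ r)
    (hφ : ContinuousOn φ (sphere 0 r)) (hf : ContinuousOn f (sphere 0 r)) {w₀ : ℂ}
    (hw₀ : w₀ ∉ f '' sphere 0 r) :
    DifferentiableAt ℂ (fun w => ∮ z in C(0, r), φ z / (f z - w)) w₀ := by
  have hK : IsCompact (f '' sphere (0 : ℂ) r) := (isCompact_sphere _ _).image_of_continuousOn hf
  obtain ⟨δ, hδ, hball⟩ := Metric.isOpen_iff.1 hK.isClosed.isOpen_compl w₀ hw₀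
  have hmem : ∀ θ, circleMap 0 r θ ∈ sphere (0 : ℂ) r := circleMap_mem_sphere 0 hr
  -- The values of f on the circle stay at distance δ from w₀, so halving the radius leaves a
  -- uniform lower bound for the denominator.
  have hlow : ∀ w ∈ ball w₀ (δ / 2), ∀ θ, δ / 2 ≤ ‖f (circleMap 0 r θ) - w‖ := by
    intro w hw θ
    by_contra! hc
    refine hball ?_ ⟨_, hmem θ, rfl⟩
    rw [mem_ball, dist_eq_norm] at hw ⊢
    calc _ = ‖(f (circleMap 0 r θ) - w) + (w - w₀)‖ := by ring_nf
      _ ≤ _ := norm_add_le _ _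
      _ < δ := by linarith
  have hne : ∀ w ∈ ball w₀ (δ / 2), ∀ θ, f (circleMap 0 r θ) - w ≠ 0 := fun w hw θ =>
    norm_pos_iff.1 ((half_pos hδ).trans_le (hlow w hw θ))
  have hφc : Continuous fun θ => φ (circleMap 0 r θ) :=
    hφ.comp_continuous (continuous_circleMap 0 r) hmem
  have hfc : Continuous fun θ => f (circleMap 0 r θ) :=
    hf.comp_continuous (continuous_circleMap 0 r) hmem
  have hdc : Continuous fun θ => deriv (circleMap 0 r) θ := by
    simp only [deriv_circleMap]
    fun_prop
  have hc : ∀ w ∈ ball w₀ (δ / 2), Continuous fun θ =>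
      deriv (circleMap 0 r) θ • (φ (circleMap 0 r θ) / (f (circleMap 0 r θ) - w)) :=
    fun w hw => hdc.smul (hφc.div (hfc.sub continuous_const) (hne w hw))
  have hw₀m : w₀ ∈ ball w₀ (δ / 2) := mem_ball_self (half_pos hδ)
  have hc' : Continuous fun θ =>
      deriv (circleMap 0 r) θ • (φ (circleMap 0 r θ) / (f (circleMap 0 r θ) - w₀) ^ 2) :=
    hdc.smul (hφc.div ((hfc.sub continuous_const).pow 2) fun θ => pow_ne_zero 2 (hne w₀ hw₀m θ))
  refine (intervalIntegral.hasDerivAt_integral_of_dominated_loc_of_deriv_le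
    (F' := fun w θ => deriv (circleMap 0 r) θ •
      (φ (circleMap 0 r θ) / (f (circleMap 0 r θ) - w) ^ 2))
    (bound := fun θ => ‖deriv (circleMap 0 r) θ‖ * (‖φ (circleMap 0 r θ)‖ / (δ / 2) ^ 2))
    (ball_mem_nhds w₀ (half_pos hδ)) ?_ ?_ hc'.aestronglyMeasurable ?_ ?_ ?_).2.differentiableAt
  · filter_upwards [ball_mem_nhds w₀ (half_pos hδ)] with w hw using (hc w hw).aestronglyMeasurable
  · exact (hc w₀ hw₀m).intervalIntegrable _ _
  · refine Eventually.of_forall fun θ _ w hw => ?_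
    rw [norm_smul, norm_div, norm_pow]
    gcongr
    exact hlow w hw θ
  · exact (hdc.norm.mul (hφc.norm.div_const _)).intervalIntegrable _ _
  · refine Eventually.of_forall fun θ _ w hw => ?_
    have h1 : HasDerivAt (fun w => f (circleMap 0 r θ) - w) (-1) w := by
      simpa using (hasDerivAt_id w).const_sub (f (circleMap 0 r θ))
    have h2 := ((hasDerivAt_const w (φ (circleMap 0 r θ))).div h1 (hne w hw θ)).const_smul
      (deriv (circleMap 0 r) θ)
    exact h2.congr_deriv (by congr 2; ring)

/-! ### Variation of fibres and traces -/

theorem FactorsAt.not_const {ι : Type*} [Fintype ι] {f : ℂ → ℂ} {w : ℂ} {a : ι → ℂ}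
    (ha : FactorsAt f w a) : ¬ ∀ z ∈ ball (0 : ℂ) 1, f z = w := fun hc =>
  (infinite_of_mem_nhds (0 : ℂ) (ball_mem_nhds 0 one_pos)) <|
    (Set.finite_range a).subset fun z hz => by
      obtain ⟨k, rfl⟩ := (ha.eq_iff hz).1 (hc z hz)
      exact ⟨k, rfl⟩

theorem exists_lt_one_forall_norm_lt {ι : Type*} [Finite ι] {a : ι → ℂ} (ha : ∀ k, ‖a k‖ < 1) :
    ∃ r : ℝ, 0 < r ∧ r < 1 ∧ ∀ k, ‖a k‖ < r := by
  have h : ∀ᶠ r : ℝ in 𝓝[<] 1, 0 < r ∧ r < 1 ∧ ∀ k, ‖a k‖ < r := by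
    refine (Filter.Eventually.filter_mono nhdsWithin_le_nhds (lt_mem_nhds one_pos)).and
      (eventually_mem_nhdsWithin.and (eventually_all.2 fun k => ?_))
    exact Filter.Eventually.filter_mono nhdsWithin_le_nhds (lt_mem_nhds (ha k))
  exact h.exists

theorem FactorsAt.circleIntegral_eq_sum {ι : Type*} [Fintype ι] {f L : ℂ → ℂ} {w : ℂ} {a : ι → ℂ}
    (ha : FactorsAt f w a) (hL : DifferentiableOn ℂ L (ball 0 1)) {r : ℝ} (hr0 : 0 < r)
    (hr1 : r < 1) (har : ∀ k, ‖a k‖ < r) :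
    (∮ z in C(0, r), L z * deriv f z / (f z - w)) = 2 * Real.pi * Complex.I * ∑ k, L (a k) := by
  rw [ha.circleIntegral_eq hL hr0 hr1 fun k => (har k).ne]
  simp [har]

/-- Both sums are the same integral over a circle enclosing all the points. This makes the trace
independent of the chosen enumeration of the fibre. -/
theorem FactorsAt.sum_eq {ι κ : Type*} [Fintype ι] [Fintype κ] {f L : ℂ → ℂ} {w : ℂ} {a : ι → ℂ}
    {b : κ → ℂ} (ha : FactorsAt f w a) (hb : FactorsAt f w b)
    (hL : DifferentiableOn ℂ L (ball 0 1)) : ∑ k, L (a k) = ∑ k, L (b k) := by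
  obtain ⟨r, hr0, hr1, hr⟩ := exists_lt_one_forall_norm_lt (a := Sum.elim a b)
    (by rintro (k | k) <;> simp [ha.1, hb.1])
  have h1 := ha.circleIntegral_eq_sum hL hr0 hr1 fun k => hr (Sum.inl k)
  rw [hb.circleIntegral_eq_sum hL hr0 hr1 fun k => hr (Sum.inr k)] at h1
  exact (mul_left_cancel₀ Complex.two_pi_I_ne_zero h1).symm

theorem FactorsAt.notMem_image_sphere {ι : Type*} [Fintype ι] {f : ℂ → ℂ} {w : ℂ} {a : ι → ℂ}
    (ha : FactorsAt f w a) {r : ℝ} (hr1 : r < 1) (har : ∀ k, ‖a k‖ < r) :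
    w ∉ f '' sphere 0 r := by
  rintro ⟨z, hz, hzw⟩
  obtain ⟨k, rfl⟩ := (ha.eq_iff (closedBall_subset_ball hr1 (sphere_subset_closedBall hz))).1 hzw
  exact (har k).ne (by simpa using hz)

theorem differentiableAt_circleIntegral_mul_deriv_div_sub {f L : ℂ → ℂ}
    (hf : DifferentiableOn ℂ f (ball 0 1)) (hL : DifferentiableOn ℂ L (ball 0 1)) {r : ℝ}
    (hr0 : 0 < r) (hr1 : r < 1) {w₀ : ℂ} (hw₀ : w₀ ∉ f '' sphere 0 r) :
    DifferentiableAt ℂ (fun w => ∮ z in C(0, r), L z * deriv f z / (f z - w)) w₀ := by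
  have hsub : sphere (0 : ℂ) r ⊆ ball 0 1 :=
    sphere_subset_closedBall.trans (closedBall_subset_ball hr1)
  exact differentiableAt_circleIntegral_div_sub hr0.le
    ((hL.mul (hf.deriv isOpen_ball)).continuousOn.mono hsub) (hf.continuousOn.mono hsub) hw₀

/-- The argument principle with L = 1 counts the fibre points of norm below r. The count is
continuous in w and integer valued, so it keeps its full value near w₀ and no point is left outside.
-/
theorem FactorsAt.eventually_norm_lt {ι : Type*} [Fintype ι] {f : ℂ → ℂ} {w₀ : ℂ} {a₀ : ι → ℂ}
    (ha₀ : FactorsAt f w₀ a₀) (hf : DifferentiableOn ℂ f (ball 0 1)) {r : ℝ} (hr0 : 0 < r)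
    (hr1 : r < 1) (har : ∀ k, ‖a₀ k‖ < r) :
    ∀ᶠ w in 𝓝 w₀, ∀ a : ι → ℂ, FactorsAt f w a → ∀ k, ‖a k‖ < r := by
  have hw₀ := ha₀.notMem_image_sphere hr1 har
  have h1 : DifferentiableOn ℂ (fun _ : ℂ => (1 : ℂ)) (ball 0 1) := differentiableOn_const _
  have hsub : sphere (0 : ℂ) r ⊆ ball 0 1 :=
    sphere_subset_closedBall.trans (closedBall_subset_ball hr1)
  have hK : IsCompact (f '' sphere (0 : ℂ) r) :=
    (isCompact_sphere _ _).image_of_continuousOn (hf.continuousOn.mono hsub)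
  have hcont := (differentiableAt_circleIntegral_mul_deriv_div_sub hf h1 hr0 hr1 hw₀).continuousAt
  -- The radius 2π is the gap between consecutive values of the counting integral.
  filter_upwards [hK.isClosed.isOpen_compl.mem_nhds hw₀,
    hcont.eventually (ball_mem_nhds _ Real.two_pi_pos)] with w hw hN a ha
  have hne : ∀ k, ‖a k‖ ≠ r := fun k hk => hw ⟨a k, by simpa using hk, ha.apply_eq k⟩
  rw [ha₀.circleIntegral_eq_sum h1 hr0 hr1 har, ha.circleIntegral_eq h1 hr0 hr1 hne,
    dist_eq_norm, ← mul_sub, norm_mul] at hN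
  have h2 : ‖(2 * Real.pi * Complex.I : ℂ)‖ = 2 * Real.pi := by
    simp [abs_of_pos Real.pi_pos]
  rw [h2, mul_lt_iff_lt_one_right Real.two_pi_pos, ← Finset.sum_sub_distrib] at hN
  by_contra! hc
  obtain ⟨k, hk⟩ := hc
  have h3 : ∑ j, ((if ‖a j‖ < r then (1 : ℂ) else 0) - 1) =
      ((-(∑ j, if ‖a j‖ < r then (0 : ℝ) else 1) : ℝ) : ℂ) := by
    push_cast
    rw [← Finset.sum_neg_distrib]
    refine Finset.sum_congr rfl fun j _ => ?_
    split_ifs <;> simp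
  rw [h3, Complex.norm_real, Real.norm_eq_abs, abs_neg] at hN
  have h4 : (1 : ℝ) ≤ ∑ j, if ‖a j‖ < r then (0 : ℝ) else 1 := by
    have := Finset.single_le_sum (f := fun j => if ‖a j‖ < r then (0 : ℝ) else 1)
      (fun j _ => by positivity) (Finset.mem_univ k)
    simpa [hk.not_gt] using this
  exact absurd ((le_abs_self _).trans_lt hN) h4.not_gt

theorem isOpen_image_of_factorsAt {ι : Type*} [Fintype ι] {f : ℂ → ℂ}
    (hf : DifferentiableOn ℂ f (ball 0 1))
    (hfac : ∀ w ∈ f '' ball 0 1, ∃ a : ι → ℂ, FactorsAt f w a) : IsOpen (f '' ball 0 1) := by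
  rcases (hf.analyticOnNhd isOpen_ball).is_constant_or_isOpen
    (convex_ball (0 : ℂ) 1).isPreconnected with ⟨w, hw⟩ | h
  · obtain ⟨a, ha⟩ := hfac w ⟨0, by simp, hw 0 (by simp)⟩
    exact absurd hw ha.not_const
  · exact h _ subset_rfl isOpen_ball

/-- The trace of `L` along `f` is analytic on the range of `f`. -/
theorem exists_differentiableOn_trace {ι : Type*} [Fintype ι] {f L : ℂ → ℂ}
    (hf : DifferentiableOn ℂ f (ball 0 1)) (hL : DifferentiableOn ℂ L (ball 0 1))
    (hfac : ∀ w ∈ f '' ball 0 1, ∃ a : ι → ℂ, FactorsAt f w a) :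
    ∃ T : ℂ → ℂ, DifferentiableOn ℂ T (f '' ball 0 1) ∧
      ∀ w ∈ f '' ball 0 1, ∀ a : ι → ℂ, FactorsAt f w a → T w = ∑ k, L (a k) := by
  choose! a ha using hfac
  refine ⟨fun w => ∑ k, L (a w k), fun w₀ hw₀ => ?_, fun w hw b hb => (ha w hw).sum_eq hb hL⟩
  obtain ⟨r, hr0, hr1, hr⟩ := exists_lt_one_forall_norm_lt (ha w₀ hw₀).1
  have hd := (differentiableAt_circleIntegral_mul_deriv_div_sub hf hL hr0 hr1
    ((ha w₀ hw₀).notMem_image_sphere hr1 hr)).const_mul (2 * Real.pi * Complex.I)⁻¹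
  -- Nearby fibres stay inside the circle chosen for w₀, so one fixed integral represents the trace
  -- around w₀.
  refine (hd.congr_of_eventuallyEq ?_).differentiableWithinAt
  filter_upwards [(ha w₀ hw₀).eventually_norm_lt hf hr0 hr1 hr,
    (isOpen_image_of_factorsAt hf fun w hw => ⟨a w, ha w hw⟩).mem_nhds hw₀] with w hw hwΩ
  rw [(ha w hwΩ).circleIntegral_eq_sum hL hr0 hr1 (hw _ (ha w hwΩ)),
    inv_mul_cancel_left₀ Complex.two_pi_I_ne_zero]

/-- Points close to the unit circle lie in fibres all of whose points are close to it. -/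
theorem exists_forall_norm_lt_of_factorsAt {ι : Type*} [Fintype ι] {f : ℂ → ℂ}
    (hf : DifferentiableOn ℂ f (ball 0 1))
    (hfac : ∀ w ∈ f '' ball 0 1, ∃ a : ι → ℂ, FactorsAt f w a) {ρ : ℝ} (hρ : ρ < 1) :
    ∃ r < 1, ∀ z ∈ ball (0 : ℂ) 1, ∀ z' ∈ closedBall (0 : ℂ) ρ, f z = f z' → ‖z‖ < r := by
  have hsub : closedBall (0 : ℂ) ρ ⊆ ball 0 1 := closedBall_subset_ball hρ
  -- Each point of the compact disk has a neighbourhood with its own r; finitely many are merged by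
  -- taking the maximum.
  refine (isCompact_closedBall (0 : ℂ) ρ).induction_on
    (p := fun s => ∃ r < 1, ∀ z ∈ ball (0 : ℂ) 1, ∀ z' ∈ s, f z = f z' → ‖z‖ < r)
    ⟨0, by simp⟩ ?_ ?_ ?_
  · rintro s t hst ⟨r, hr, h⟩
    exact ⟨r, hr, fun z hz z' hz' => h z hz z' (hst hz')⟩
  · rintro s t ⟨r, hr, h⟩ ⟨r', hr', h'⟩
    refine ⟨max r r', max_lt hr hr', fun z hz z' hz' e => lt_max_iff.2 ?_⟩
    exact hz'.imp (fun hz' => h z hz z' hz' e) fun hz' => h' z hz z' hz' e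
  · intro z₀ hz₀
    obtain ⟨a₀, ha₀⟩ := hfac _ ⟨z₀, hsub hz₀, rfl⟩
    obtain ⟨r, hr0, hr1, hr⟩ := exists_lt_one_forall_norm_lt ha₀.1
    have hev := ha₀.eventually_norm_lt hf hr0 hr1 hr
    have hnb := isOpen_ball.mem_nhds (hsub hz₀)
    refine ⟨_, mem_nhdsWithin_of_mem_nhds
      (((hf.differentiableAt hnb).continuousAt.eventually hev).and hnb), r, hr1, ?_⟩
    rintro z hz z' ⟨hz', hz'b⟩ e
    obtain ⟨a, ha⟩ := hfac _ ⟨z', hz'b, rfl⟩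
    obtain ⟨k, rfl⟩ := (ha.eq_iff hz).1 e
    exact hz' a ha k

/-! ### Logarithms and the maximum principle -/

theorem exists_exp_eq_of_differentiableOn_ball {q : ℂ → ℂ} (hq : DifferentiableOn ℂ q (ball 0 1))
    (hq0 : ∀ z ∈ ball (0 : ℂ) 1, q z ≠ 0) :
    ∃ L : ℂ → ℂ, DifferentiableOn ℂ L (ball 0 1) ∧
      ∀ z ∈ ball (0 : ℂ) 1, Complex.exp (L z) = q z := by
  have h0 : (0 : ℂ) ∈ ball (0 : ℂ) 1 := mem_ball_self one_pos
  obtain ⟨L, hL0, hL⟩ := ((hq.deriv isOpen_ball).div hq hq0).isExactOn_ball.with_val_at 0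
    (Complex.log (q 0))
  refine ⟨L, fun z hz => (hL z hz).differentiableAt.differentiableWithinAt, fun z hz => ?_⟩
  have hd : ∀ z ∈ ball (0 : ℂ) 1, HasDerivAt (fun z => Complex.exp (L z) / q z) 0 z := by
    intro z hz
    have h1 := (hL z hz).cexp.div
      (hq.differentiableAt (isOpen_ball.mem_nhds hz)).hasDerivAt (hq0 z hz)
    refine h1.congr_deriv ?_
    have := hq0 z hz
    simp only [Pi.div_apply]
    field_simp
    ring
  have hc := isOpen_ball.is_const_of_deriv_eq_zero (convex_ball (0 : ℂ) 1).isPreconnected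
    (fun z hz => (hd z hz).differentiableAt.differentiableWithinAt)
    (fun z hz => (hd z hz).deriv) hz h0
  simp only [hL0, Complex.exp_log (hq0 0 h0), div_self (hq0 0 h0)] at hc
  rwa [div_eq_one_iff_eq (hq0 z hz)] at hc

/-- No boundary values are needed: the maximum principle is applied on disks of radius s < 1 with s
beyond both r and the norm of z. -/
theorem norm_le_one_of_boundary {E : ℂ → ℂ} (hE : DifferentiableOn ℂ E (ball 0 1))
    (hb : ∀ C > 1, ∃ r < (1 : ℝ), ∀ z ∈ ball (0 : ℂ) 1, r ≤ ‖z‖ → ‖E z‖ ≤ C) {z : ℂ}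
    (hz : z ∈ ball (0 : ℂ) 1) : ‖E z‖ ≤ 1 := by
  refine le_of_forall_gt_imp_ge_of_dense fun C hC => ?_
  obtain ⟨r, hr, h⟩ := hb C hC
  rw [mem_ball_zero_iff] at hz
  obtain ⟨s, hs, hs1⟩ := exists_between (max_lt hr hz)
  have hs0 : 0 < s := (norm_nonneg z).trans_lt ((le_max_right _ _).trans_lt hs)
  have hcl : closure (ball (0 : ℂ) s) ⊆ ball 0 1 := by
    rw [closure_ball _ hs0.ne']
    exact closedBall_subset_ball hs1
  refine Complex.norm_le_of_forall_mem_frontier_norm_le isBounded_ball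
    (hE.mono hcl).diffContOnCl (fun y hy => ?_)
    (subset_closure (mem_ball_zero_iff.2 ((le_max_right _ _).trans_lt hs)))
  rw [frontier_ball _ hs0.ne', mem_sphere_zero_iff_norm] at hy
  refine h y (by simpa [hy] using hs1) ?_
  rw [hy]
  exact ((le_max_left _ _).trans_lt hs).le

/-- The bound for exp ψ and exp(-ψ) together force modulus 1, so the norm of exp ψ has an interior
maximum, exp ψ is constant, and ψ' vanishes. -/
theorem eq_const_of_norm_exp_boundary {ψ : ℂ → ℂ} (hψ : DifferentiableOn ℂ ψ (ball 0 1))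
    (hb : ∀ C > 1, ∃ r < (1 : ℝ), ∀ z ∈ ball (0 : ℂ) 1, r ≤ ‖z‖ →
      ‖Complex.exp (ψ z)‖ ≤ C ∧ ‖Complex.exp (-ψ z)‖ ≤ C) {z : ℂ}
    (hz : z ∈ ball (0 : ℂ) 1) : ψ z = ψ 0 := by
  have h0 : (0 : ℂ) ∈ ball (0 : ℂ) 1 := mem_ball_self one_pos
  have hle : ∀ z ∈ ball (0 : ℂ) 1, ‖Complex.exp (ψ z)‖ ≤ 1 := fun z hz =>
    norm_le_one_of_boundary hψ.cexp (fun C hC => by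
      obtain ⟨r, hr, h⟩ := hb C hC
      exact ⟨r, hr, fun z hz hrz => (h z hz hrz).1⟩) hz
  have hge : ∀ z ∈ ball (0 : ℂ) 1, ‖Complex.exp (-ψ z)‖ ≤ 1 := fun z hz =>
    norm_le_one_of_boundary (E := fun z => Complex.exp (-ψ z)) hψ.neg.cexp (fun C hC => by
      obtain ⟨r, hr, h⟩ := hb C hC
      exact ⟨r, hr, fun z hz hrz => (h z hz hrz).2⟩) hz
  have hmax : IsMaxOn (norm ∘ fun z => Complex.exp (ψ z)) (ball 0 1) 0 := by
    intro z hz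
    have h2 := hge 0 h0
    rw [Complex.exp_neg, norm_inv, inv_le_one₀ (norm_pos_iff.2 (Complex.exp_ne_zero _))] at h2
    exact (hle z hz).trans h2
  have hconst := Complex.eq_const_of_exists_max hψ.cexp h0 hmax
  refine isOpen_ball.is_const_of_deriv_eq_zero (convex_ball (0 : ℂ) 1).isPreconnected hψ
    (fun y hy => ?_) hz h0
  have h1 : HasDerivAt (fun z => Complex.exp (ψ z)) (Complex.exp (ψ y) * deriv ψ y) y :=
    (hψ.differentiableAt (isOpen_ball.mem_nhds hy)).hasDerivAt.cexp
  have h2 : HasDerivAt (fun z => Complex.exp (ψ z)) 0 y :=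
    (hasDerivAt_const y (Complex.exp (ψ 0))).congr_of_eventuallyEq <| by
      filter_upwards [isOpen_ball.mem_nhds hy] with x hx using hconst hx
  exact (mul_eq_zero.1 (h1.unique h2)).resolve_left (Complex.exp_ne_zero _)

/-! ### Estimates for Blaschke products -/

/-- The finite Blaschke product with zeros `a k`. -/
noncomputable def blaschke {ι : Type*} [Fintype ι] (a : ι → ℂ) (z : ℂ) : ℂ :=
  ∏ k, (z - a k) / (1 - (starRingEnd ℂ) (a k) * z)

theorem one_sub_conj_mul_ne_zero {a z : ℂ} (ha : ‖a‖ < 1) (hz : ‖z‖ ≤ 1) :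
    1 - (starRingEnd ℂ) a * z ≠ 0 := by
  intro h
  have h1 : ‖(starRingEnd ℂ) a * z‖ = 1 := by rw [← sub_eq_zero.1 h, norm_one]
  rw [norm_mul, Complex.norm_conj] at h1
  nlinarith [norm_nonneg a, norm_nonneg z]

/-- The sign of the right side tells whether a Blaschke factor is below, on or above modulus 1. -/
theorem norm_one_sub_conj_mul_sq_sub (a z : ℂ) :
    ‖1 - (starRingEnd ℂ) a * z‖ ^ 2 - ‖z - a‖ ^ 2 = (1 - ‖a‖ ^ 2) * (1 - ‖z‖ ^ 2) := by
  simp only [Complex.sq_norm, Complex.normSq_apply, Complex.sub_re, Complex.sub_im, Complex.mul_re,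
    Complex.mul_im, Complex.one_re, Complex.one_im, Complex.conj_re, Complex.conj_im]
  ring

theorem norm_sub_le_norm_one_sub_conj_mul {a z : ℂ} (ha : ‖a‖ < 1) (hz : ‖z‖ ≤ 1) :
    ‖z - a‖ ≤ ‖1 - (starRingEnd ℂ) a * z‖ := by
  refine le_of_sq_le_sq ?_ (norm_nonneg _)
  rw [← sub_nonneg, norm_one_sub_conj_mul_sq_sub]
  have := norm_nonneg a
  have := norm_nonneg z
  exact mul_nonneg (by nlinarith) (by nlinarith)

theorem norm_sub_lt_norm_one_sub_conj_mul {a z : ℂ} (ha : ‖a‖ < 1) (hz : ‖z‖ < 1) :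
    ‖z - a‖ < ‖1 - (starRingEnd ℂ) a * z‖ := by
  refine lt_of_pow_lt_pow_left₀ 2 (norm_nonneg _) ?_
  rw [← sub_pos, norm_one_sub_conj_mul_sq_sub]
  have := norm_nonneg a
  have := norm_nonneg z
  exact mul_pos (by nlinarith) (by nlinarith)

theorem norm_one_sub_conj_mul_le_norm_sub {a z : ℂ} (ha : ‖a‖ < 1) (hz : 1 ≤ ‖z‖) :
    ‖1 - (starRingEnd ℂ) a * z‖ ≤ ‖z - a‖ := by
  refine le_of_sq_le_sq ?_ (norm_nonneg _)
  rw [← sub_nonpos, norm_one_sub_conj_mul_sq_sub]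
  have := norm_nonneg a
  exact mul_nonpos_of_nonneg_of_nonpos (by nlinarith) (by nlinarith)

section Blaschke

variable {ι : Type*} [Fintype ι] {a : ι → ℂ}

theorem differentiableOn_blaschke (ha : ∀ k, ‖a k‖ < 1) :
    DifferentiableOn ℂ (blaschke a) (closedBall 0 1) := by
  unfold blaschke
  refine DifferentiableOn.fun_finsetProd fun k _ => DifferentiableOn.fun_div (by fun_prop)
    (by fun_prop) fun z hz => ?_
  exact one_sub_conj_mul_ne_zero (ha k) (by simpa using hz)

theorem norm_blaschke_le_one (ha : ∀ k, ‖a k‖ < 1) {z : ℂ} (hz : ‖z‖ ≤ 1) :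
    ‖blaschke a z‖ ≤ 1 := by
  rw [blaschke, norm_prod]
  refine Finset.prod_le_one (fun _ _ => norm_nonneg _) fun k _ => ?_
  rw [norm_div]
  exact div_le_one_of_le₀ (norm_sub_le_norm_one_sub_conj_mul (ha k) hz) (norm_nonneg _)

theorem one_le_norm_blaschke (ha : ∀ k, ‖a k‖ < 1) {z : ℂ} (hz : ‖z‖ = 1) :
    1 ≤ ‖blaschke a z‖ := by
  rw [blaschke, norm_prod]
  calc (1 : ℝ) = ∏ _k : ι, 1 := by simp
    _ ≤ _ := Finset.prod_le_prod (fun _ _ => zero_le_one) fun k _ => ?_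
  rw [norm_div, one_le_div (norm_pos_iff.2 (one_sub_conj_mul_ne_zero (ha k) hz.le))]
  exact norm_one_sub_conj_mul_le_norm_sub (ha k) hz.ge

theorem norm_blaschke_lt_one [Nonempty ι] (ha : ∀ k, ‖a k‖ < 1) {z : ℂ} (hz : ‖z‖ < 1) :
    ‖blaschke a z‖ < 1 := by
  classical
  obtain ⟨j⟩ := ‹Nonempty ι›
  rw [blaschke, ← Finset.mul_prod_erase _ _ (Finset.mem_univ j), norm_mul, norm_prod]
  refine mul_lt_one_of_nonneg_of_lt_one_left (norm_nonneg _) ?_ ?_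
  · rw [norm_div, div_lt_one (norm_pos_iff.2 (one_sub_conj_mul_ne_zero (ha j) hz.le))]
    exact norm_sub_lt_norm_one_sub_conj_mul (ha j) hz
  · refine Finset.prod_le_one (fun _ _ => norm_nonneg _) fun k _ => ?_
    rw [norm_div]
    exact div_le_one_of_le₀ (norm_sub_le_norm_one_sub_conj_mul (ha k) hz.le) (norm_nonneg _)

/-- The part of the closed disk where the modulus is at most t is compact and misses the circle; ρ
is the largest norm on it. -/
theorem exists_lt_norm_blaschke (ha : ∀ k, ‖a k‖ < 1) {t : ℝ} (ht : t < 1) :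
    ∃ ρ < (1 : ℝ), ∀ z ∈ ball (0 : ℂ) 1, ρ < ‖z‖ → t < ‖blaschke a z‖ := by
  have hK : IsCompact (closedBall (0 : ℂ) 1 ∩ (fun z => ‖blaschke a z‖) ⁻¹' Set.Iic t) :=
    (isCompact_closedBall (0 : ℂ) 1).of_isClosed_subset
      ((differentiableOn_blaschke ha).continuousOn.norm.preimage_isClosed_of_isClosed
        isClosed_closedBall isClosed_Iic) Set.inter_subset_left
  rcases (closedBall (0 : ℂ) 1 ∩ (fun z => ‖blaschke a z‖) ⁻¹' Set.Iic t).eq_empty_or_nonempty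
    with he | hne
  · refine ⟨0, one_pos, fun z hz _ => ?_⟩
    by_contra! hc
    exact (he ▸ ⟨ball_subset_closedBall hz, hc⟩ : z ∈ (∅ : Set ℂ))
  · obtain ⟨m, ⟨hm1, hm2⟩, hmax⟩ := hK.exists_isMaxOn hne continuous_norm.continuousOn
    rw [mem_closedBall_zero_iff] at hm1
    refine ⟨‖m‖, lt_of_le_of_ne hm1 fun h => ?_, fun z hz hlt => ?_⟩
    · exact absurd ((one_le_norm_blaschke ha h).trans hm2) ht.not_ge
    · by_contra! hc
      exact absurd (hmax ⟨ball_subset_closedBall hz, hc⟩) (not_le.2 hlt)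

end Blaschke

/-! ### The Blaschke product as a function of f -/

theorem exists_pow_ge_inv {C : ℝ} (hC : 1 < C) (n : ℕ) :
    ∃ t : ℝ, 0 < t ∧ t < 1 ∧ 1 ≤ C * t ^ n := by
  have h1 : ∀ᶠ t : ℝ in 𝓝 1, 1 < C * t ^ n :=
    (by fun_prop : Continuous fun t : ℝ => C * t ^ n).continuousAt.eventually
      (lt_mem_nhds (by simpa using hC))
  obtain ⟨t, ⟨h1, h2⟩, h3⟩ := (((h1.and (lt_mem_nhds one_pos)).filter_mono
    (nhdsWithin_le_nhds (s := Set.Iio 1))).and eventually_mem_nhdsWithin).exists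
  exact ⟨t, h2, h3, h1.le⟩

/-- The Blaschke product whose zeros form one fibre of `f` is an analytic function of `f`. -/
theorem exists_blaschke_eq_comp {n : ℕ} {f : ℂ → ℂ} (hn0 : n ≠ 0)
    (hf : DifferentiableOn ℂ f (ball 0 1))
    (hfac : ∀ w ∈ f '' ball 0 1, ∃ a : Fin n → ℂ, FactorsAt f w a) {w₀ : ℂ} {a : Fin n → ℂ}
    (ha : FactorsAt f w₀ a) :
    ∃ Φ : ℂ → ℂ, DifferentiableOn ℂ Φ (f '' ball 0 1) ∧
      ∀ z ∈ ball (0 : ℂ) 1, blaschke a z = Φ (f z) := by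
  obtain ⟨ha1, h, hh, hh0, he⟩ := id ha
  have hden : ∀ z ∈ ball (0 : ℂ) 1, ∀ k, 1 - (starRingEnd ℂ) (a k) * z ≠ 0 := fun z hz k =>
    one_sub_conj_mul_ne_zero (ha1 k) (mem_ball_zero_iff.1 hz).le
  -- L is a logarithm of B/(f - w₀), whose zeros and poles cancel.
  obtain ⟨L, hL, hLq⟩ := exists_exp_eq_of_differentiableOn_ball
    (q := fun z => (h z * ∏ k, (1 - (starRingEnd ℂ) (a k) * z))⁻¹)
    (DifferentiableOn.fun_inv (hh.mul (by fun_prop)) fun z hz =>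
      mul_ne_zero (hh0 z hz) (Finset.prod_ne_zero_iff.2 fun k _ => hden z hz k))
    (fun z hz => inv_ne_zero <|
      mul_ne_zero (hh0 z hz) (Finset.prod_ne_zero_iff.2 fun k _ => hden z hz k))
  have hB : ∀ z ∈ ball (0 : ℂ) 1, blaschke a z = (f z - w₀) * Complex.exp (L z) := by
    intro z hz
    rw [hLq z hz, he z hz, blaschke, Finset.prod_div_distrib, mul_inv, div_eq_mul_inv]
    have := hh0 z hz
    field_simp
  obtain ⟨T, hT, hTsum⟩ := exists_differentiableOn_trace hf hL hfac
  have hψ : DifferentiableOn ℂ (fun z => n * L z - T (f z)) (ball 0 1) :=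
    (hL.const_mul _).sub (hT.comp hf (Set.mapsTo_image _ _))
  have hconst := fun z (hz : z ∈ ball (0 : ℂ) 1) => eq_const_of_norm_exp_boundary hψ (z := z)
    (fun C hC => by
      obtain ⟨t, ht0, ht1, hCt⟩ := exists_pow_ge_inv hC n
      obtain ⟨ρ, hρ, hBρ⟩ := exists_lt_norm_blaschke ha1 ht1
      obtain ⟨r, hr, hprop⟩ := exists_forall_norm_lt_of_factorsAt hf hfac hρ
      have hlow : ∀ z ∈ ball (0 : ℂ) 1, r ≤ ‖z‖ → ∀ z' ∈ ball (0 : ℂ) 1, f z = f z' →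
          t < ‖blaschke a z'‖ := by
        intro z hz hrz z' hz' e
        refine hBρ z' hz' ?_
        by_contra! hc
        exact (hprop z hz z' (by simpa using hc) e).not_ge hrz
      refine ⟨r, hr, fun z hz hrz => ?_⟩
      obtain ⟨b, hb⟩ := hfac _ ⟨z, hz, rfl⟩
      have hbm : ∀ k, b k ∈ ball (0 : ℂ) 1 := fun k => by simpa using hb.1 k
      -- Since f - w₀ is constant on the fibre, both sides carry the same factor (f - w₀)^n; the
      -- rest is the definition of the trace.
      have hkey : Complex.exp (n * L z - T (f z)) * ∏ k, blaschke a (b k) =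
          blaschke a z ^ n := by
        simp only [hB _ hz, hB _ (hbm _), hb.apply_eq, Finset.prod_mul_distrib, Finset.prod_const,
          Finset.card_univ, Fintype.card_fin, mul_pow, hTsum _ ⟨z, hz, rfl⟩ b hb, Complex.exp_sub,
          Complex.exp_sum, Complex.exp_nat_mul]
        have : ∏ k, Complex.exp (L (b k)) ≠ 0 :=
          Finset.prod_ne_zero_iff.2 fun k _ => Complex.exp_ne_zero _
        field_simp
      have hnorm := congrArg norm hkey
      rw [norm_mul, norm_pow, norm_prod] at hnorm
      have hP1 : ∏ k, ‖blaschke a (b k)‖ ≤ 1 := Finset.prod_le_one (fun _ _ => norm_nonneg _)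
        fun k _ => norm_blaschke_le_one ha1 (hb.1 k).le
      have hPt : t ^ n ≤ ∏ k, ‖blaschke a (b k)‖ := by
        calc t ^ n = ∏ _k : Fin n, t := by simp
          _ ≤ _ := Finset.prod_le_prod (fun _ _ => ht0.le) fun k _ =>
            (hlow z hz hrz _ (hbm k) (hb.apply_eq k).symm).le
      have hz1 : ‖blaschke a z‖ ^ n ≤ 1 := pow_le_one₀ (norm_nonneg _)
        (norm_blaschke_le_one ha1 (mem_ball_zero_iff.1 hz).le)
      have hzt : t ^ n ≤ ‖blaschke a z‖ ^ n := pow_le_pow_left₀ ht0.le (hlow z hz hrz z hz rfl).le n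
      have htn : 0 < t ^ n := pow_pos ht0 n
      have hE := norm_nonneg (Complex.exp (n * L z - T (f z)))
      refine ⟨?_, ?_⟩
      · refine le_of_mul_le_mul_right ?_ htn
        calc _ ≤ _ := mul_le_mul_of_nonneg_left hPt hE
          _ ≤ 1 := hnorm.trans_le hz1
          _ ≤ _ := hCt
      · rw [Complex.exp_neg, norm_inv]
        refine inv_le_of_inv_le₀ (one_pos.trans hC) ?_
        calc C⁻¹ ≤ t ^ n := by rwa [inv_le_iff_one_le_mul₀' (one_pos.trans hC)]
          _ ≤ _ := hzt
          _ = _ := hnorm.symm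
          _ ≤ _ := mul_le_of_le_one_right hE hP1) hz
  -- Solving nL - T ∘ f = const for L expresses B = (f - w₀) exp L through f alone.
  refine ⟨fun w => (w - w₀) * Complex.exp ((T w + (n * L 0 - T (f 0))) / n),
    (by fun_prop : DifferentiableOn ℂ (fun w => w - w₀) _).mul
      ((hT.add_const _).div_const _).cexp, fun z hz => ?_⟩
  have hnc : (n : ℂ) ≠ 0 := Nat.cast_ne_zero.2 hn0
  have h1 : L z = (T (f z) + (n * L 0 - T (f 0))) / n := by
    have := hconst z hz
    rw [← this]
    field_simp
    ring
  rw [hB z hz]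
  simp only [← h1]

/-! ### Fibres of a Blaschke product -/

section BlaschkePolynomial

variable {n : ℕ} {a : Fin n → ℂ} {u : ℂ}

open Polynomial in
/-- The polynomial whose zeros are the solutions of `blaschke a z = u`. -/
noncomputable def blaschkePolynomial {n : ℕ} (a : Fin n → ℂ) (u : ℂ) : ℂ[X] :=
  ∏ k, (X - C (a k)) - C u * ∏ k, (C (-(starRingEnd ℂ) (a k)) * X + C 1)

theorem eval_blaschkePolynomial (z : ℂ) : (blaschkePolynomial a u).eval z =
    ∏ k, (z - a k) - u * ∏ k, (1 - (starRingEnd ℂ) (a k) * z) := by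
  simp only [blaschkePolynomial, Polynomial.eval_sub, Polynomial.eval_mul, Polynomial.eval_prod,
    Polynomial.eval_add, Polynomial.eval_C, Polynomial.eval_X]
  congr 2
  exact Finset.prod_congr rfl fun k _ => by ring

theorem eval_blaschkePolynomial_eq (ha : ∀ k, ‖a k‖ < 1) {z : ℂ} (hz : z ∈ ball (0 : ℂ) 1) :
    (blaschkePolynomial a u).eval z =
      (blaschke a z - u) * ∏ k, (1 - (starRingEnd ℂ) (a k) * z) := by
  have : ∏ k, (1 - (starRingEnd ℂ) (a k) * z) ≠ 0 := Finset.prod_ne_zero_iff.2 fun k _ =>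
    one_sub_conj_mul_ne_zero (ha k) (mem_ball_zero_iff.1 hz).le
  rw [eval_blaschkePolynomial, blaschke, Finset.prod_div_distrib, sub_mul, div_mul_cancel₀ _ this]

theorem natDegree_blaschkePolynomial_le : (blaschkePolynomial a u).natDegree ≤ n := by
  refine (Polynomial.natDegree_sub_le _ _).trans (max_le ?_ ?_)
  · refine (Polynomial.natDegree_prod_le _ _).trans ?_
    simp
  · refine (Polynomial.natDegree_C_mul_le _ _).trans
      ((Polynomial.natDegree_prod_le _ _).trans ?_)
    refine (Finset.sum_le_card_nsmul _ _ 1 fun k _ => Polynomial.natDegree_linear_le).trans ?_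
    simp

theorem coeff_blaschkePolynomial : (blaschkePolynomial a u).coeff n =
    1 - u * ∏ k, -(starRingEnd ℂ) (a k) := by
  have h1 := Polynomial.coeff_prod_of_natDegree_le (s := Finset.univ)
    (fun k : Fin n => Polynomial.X - Polynomial.C (a k)) 1
    (fun k _ => (Polynomial.natDegree_X_sub_C _).le)
  have h2 := Polynomial.coeff_prod_of_natDegree_le (s := Finset.univ) (fun k : Fin n =>
    Polynomial.C (-(starRingEnd ℂ) (a k)) * Polynomial.X + Polynomial.C 1) 1
    (fun k _ => Polynomial.natDegree_linear_le)
  simp only [Finset.card_univ, Fintype.card_fin, mul_one] at h1 h2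
  rw [blaschkePolynomial, Polynomial.coeff_sub, Polynomial.coeff_C_mul, h1, h2]
  simp [Polynomial.coeff_one, Polynomial.coeff_X, Polynomial.coeff_C]

/-- Ensures degree exactly n, so that no solution escapes to infinity. -/
theorem coeff_blaschkePolynomial_ne_zero (ha : ∀ k, ‖a k‖ < 1) (hu : ‖u‖ < 1) :
    (blaschkePolynomial a u).coeff n ≠ 0 := by
  rw [coeff_blaschkePolynomial]
  intro h
  have h1 : ‖u * ∏ k, -(starRingEnd ℂ) (a k)‖ = 1 := by rw [← sub_eq_zero.1 h, norm_one]
  rw [norm_mul, norm_prod] at h1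
  have h2 : ∏ k, ‖-(starRingEnd ℂ) (a k)‖ ≤ 1 :=
    Finset.prod_le_one (fun _ _ => norm_nonneg _) fun k _ => by simpa using (ha k).le
  exact (mul_lt_one_of_nonneg_of_lt_one_left (norm_nonneg u) hu h2).ne h1

theorem norm_lt_one_of_eval_blaschkePolynomial_eq_zero (ha : ∀ k, ‖a k‖ < 1) (hu : ‖u‖ < 1)
    {z : ℂ} (hz : (blaschkePolynomial a u).eval z = 0) : ‖z‖ < 1 := by
  by_contra! h
  rw [eval_blaschkePolynomial, sub_eq_zero] at hz
  have h1 := congrArg norm hz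
  rw [norm_mul, norm_prod, norm_prod] at h1
  have h2 : ∏ k, ‖1 - (starRingEnd ℂ) (a k) * z‖ ≤ ∏ k, ‖z - a k‖ :=
    Finset.prod_le_prod (fun _ _ => norm_nonneg _) fun k _ =>
      norm_one_sub_conj_mul_le_norm_sub (ha k) h
  have h3 : 0 < ∏ k, ‖z - a k‖ := Finset.prod_pos fun k _ => by
    rw [norm_pos_iff, sub_ne_zero]
    rintro rfl
    exact (ha k).not_ge h
  nlinarith [norm_nonneg u, mul_le_mul_of_nonneg_left h2 (norm_nonneg u)]

/-- The polynomial has n roots, all in the disk, and differs from B - u by a factor without zeros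
there. Thus traces along B are available too. -/
theorem exists_factorsAt_blaschke (ha : ∀ k, ‖a k‖ < 1) (hu : ‖u‖ < 1) :
    ∃ b : Fin n → ℂ, FactorsAt (blaschke a) u b := by
  have hlc := coeff_blaschkePolynomial_ne_zero ha hu
  have hdeg : (blaschkePolynomial a u).natDegree = n :=
    le_antisymm natDegree_blaschkePolynomial_le (Polynomial.le_natDegree_of_ne_zero hlc)
  have hne : blaschkePolynomial a u ≠ 0 := fun h => hlc (by rw [h, Polynomial.coeff_zero])
  have hsplit := IsAlgClosed.splits (blaschkePolynomial a u)
  obtain ⟨b, hb⟩ : ∃ b : Fin n → ℂ, (blaschkePolynomial a u).roots = Finset.univ.val.map b := by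
    have hcard := hsplit.natDegree_eq_card_roots
    rw [hdeg] at hcard
    generalize (blaschkePolynomial a u).roots = s at hcard
    induction s using Quotient.inductionOn with | h l =>
    simp only [Multiset.quot_mk_to_coe, Multiset.coe_card] at hcard ⊢
    subst hcard
    exact ⟨l.get, by simp [Fin.univ_val_map]⟩
  have heval : ∀ z, (blaschkePolynomial a u).eval z =
      (∏ k, (z - b k)) * (blaschkePolynomial a u).leadingCoeff := by
    intro z
    conv_lhs => rw [hsplit.eq_prod_roots, hb, Multiset.map_map, ← Finset.prod_eq_multiset_prod]
    simp [Polynomial.eval_prod, mul_comm]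
  have hden : ∀ z ∈ ball (0 : ℂ) 1, ∏ k, (1 - (starRingEnd ℂ) (a k) * z) ≠ 0 := fun z hz =>
    Finset.prod_ne_zero_iff.2 fun k _ =>
      one_sub_conj_mul_ne_zero (ha k) (mem_ball_zero_iff.1 hz).le
  refine ⟨b, fun k => norm_lt_one_of_eval_blaschkePolynomial_eq_zero ha hu (u := u) ?_,
    fun z => (blaschkePolynomial a u).leadingCoeff / ∏ k, (1 - (starRingEnd ℂ) (a k) * z),
    DifferentiableOn.fun_div (by fun_prop) (by fun_prop) hden,
    fun z hz => div_ne_zero (Polynomial.leadingCoeff_ne_zero.2 hne) (hden z hz), fun z hz => ?_⟩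
  · rw [heval, Finset.prod_eq_zero (Finset.mem_univ k) (sub_self _), zero_mul]
  · rw [← mul_div_assoc, ← heval, eval_blaschkePolynomial_eq ha hz,
      mul_div_cancel_right₀ _ (hden z hz)]

end BlaschkePolynomial

/-! ### f as a function of the Blaschke product -/

/-- Counts zeros with multiplicity, as the points may repeat: one linear factor is cancelled at a
time, and continuity of q restores the identity at the cancelled point. -/
theorem card_le_natDegree_of_eval_eq_prod_mul {κ : Type*} (s : Finset κ) {c : κ → ℂ} {U : Set ℂ}
    (hU : IsOpen U) (hc : ∀ k ∈ s, c k ∈ U) {q : ℂ → ℂ} (hq : ContinuousOn q U)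
    {P : Polynomial ℂ} (hP : P ≠ 0) (h : ∀ z ∈ U, P.eval z = (∏ k ∈ s, (z - c k)) * q z) :
    s.card ≤ P.natDegree := by
  classical
  induction s using Finset.induction_on generalizing P with
  | empty => simp
  | insert j s hj ih =>
    have hcU := hc j (Finset.mem_insert_self j s)
    have hroot : P.IsRoot (c j) := by
      rw [Polynomial.IsRoot, h _ hcU, Finset.prod_insert hj, sub_self, zero_mul, zero_mul]
    obtain ⟨Q, rfl⟩ := Polynomial.dvd_iff_isRoot.2 hroot
    have hQ : Q ≠ 0 := right_ne_zero_of_mul hP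
    have hoff : ∀ z ∈ U, z ≠ c j → Q.eval z = (∏ k ∈ s, (z - c k)) * q z := by
      intro z hz hne
      have h1 := h z hz
      rw [Finset.prod_insert hj, Polynomial.eval_mul, mul_assoc] at h1
      simp only [Polynomial.eval_sub, Polynomial.eval_X, Polynomial.eval_C] at h1
      exact mul_left_cancel₀ (sub_ne_zero.2 hne) h1
    have hon : Q.eval (c j) = (∏ k ∈ s, (c j - c k)) * q (c j) := by
      have hnb := hU.mem_nhds hcU
      refine Filter.EventuallyEq.eq_of_nhds (f := fun z => Q.eval z)
        (g := fun z => (∏ k ∈ s, (z - c k)) * q z)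
        ((ContinuousAt.eventuallyEq_nhds_iff_eventuallyEq_nhdsNE ?_ ?_).1 ?_)
      · exact Q.continuous.continuousAt
      · exact ContinuousAt.mul (by fun_prop) (hq.continuousAt hnb)
      · filter_upwards [mem_nhdsWithin_of_mem_nhds hnb, self_mem_nhdsWithin] with z hz hne
        exact hoff z hz hne
    have hle := ih (fun k hk => hc k (Finset.mem_insert_of_mem hk)) hQ fun z hz => by
      by_cases hzc : z = c j
      · rw [hzc, hon]
      · exact hoff z hz hzc
    rw [Finset.card_insert_of_notMem hj,
      Polynomial.natDegree_mul (Polynomial.X_sub_C_ne_zero _) hQ, Polynomial.natDegree_X_sub_C]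
    omega

/-- If a Blaschke product of order `n` is an analytic function of an `n`-to-one map `f`, then
conversely `f` is determined by the Blaschke product. -/
theorem eq_of_blaschke_eq {n : ℕ} {f Φ : ℂ → ℂ} (hn0 : n ≠ 0)
    (hf : DifferentiableOn ℂ f (ball 0 1))
    (hfac : ∀ w ∈ f '' ball 0 1, ∃ a : Fin n → ℂ, FactorsAt f w a) {a : Fin n → ℂ}
    (ha : ∀ k, ‖a k‖ < 1) (hΦ : DifferentiableOn ℂ Φ (f '' ball 0 1))
    (hB : ∀ z ∈ ball (0 : ℂ) 1, blaschke a z = Φ (f z)) {z₁ z₂ : ℂ}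
    (hz₁ : z₁ ∈ ball (0 : ℂ) 1) (hz₂ : z₂ ∈ ball (0 : ℂ) 1)
    (h : blaschke a z₁ = blaschke a z₂) : f z₁ = f z₂ := by
  by_contra hne
  have : NeZero n := ⟨hn0⟩
  have hopen := isOpen_image_of_factorsAt hf hfac
  obtain ⟨b₁, hb₁, h₁, hh₁, -, he₁⟩ := hfac _ ⟨z₁, hz₁, rfl⟩
  obtain ⟨b₂, hb₂, h₂, hh₂, -, he₂⟩ := hfac _ ⟨z₂, hz₂, rfl⟩
  -- Two successive slopes divide Φ - u by both (w - f z₁) and (w - f z₂).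
  have hψ : DifferentiableOn ℂ (dslope Φ (f z₁)) (f '' ball 0 1) :=
    (Complex.differentiableOn_dslope (hopen.mem_nhds ⟨z₁, hz₁, rfl⟩)).2 hΦ
  have hχ : DifferentiableOn ℂ (dslope (dslope Φ (f z₁)) (f z₂)) (f '' ball 0 1) :=
    (Complex.differentiableOn_dslope (hopen.mem_nhds ⟨z₂, hz₂, rfl⟩)).2 hψ
  have hψ0 : dslope Φ (f z₁) (f z₂) = 0 := by
    have h1 := sub_smul_dslope Φ (f z₁) (f z₂)
    rw [← hB z₁ hz₁, ← hB z₂ hz₂, h, sub_self, smul_eq_zero] at h1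
    exact h1.resolve_left (sub_ne_zero.2 (Ne.symm hne))
  have hΦχ : ∀ w, Φ w - Φ (f z₁) =
      (w - f z₁) * ((w - f z₂) * dslope (dslope Φ (f z₁)) (f z₂) w) := by
    intro w
    have h1 := sub_smul_dslope Φ (f z₁) w
    have h2 := sub_smul_dslope (dslope Φ (f z₁)) (f z₂) w
    rw [hψ0, sub_zero, smul_eq_mul] at h2
    rw [h2, ← h1, smul_eq_mul]
  have hu : ‖blaschke a z₁‖ < 1 := norm_blaschke_lt_one ha (mem_ball_zero_iff.1 hz₁)
  have hP : blaschkePolynomial a (blaschke a z₁) ≠ 0 := fun h0 =>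
    coeff_blaschkePolynomial_ne_zero ha hu (by rw [h0, Polynomial.coeff_zero])
  -- Each of the two factors pulls back under f to n linear factors: 2n zeros for a polynomial of
  -- degree at most n.
  have hcard := card_le_natDegree_of_eval_eq_prod_mul (Finset.univ : Finset (Fin n ⊕ Fin n))
    (c := Sum.elim b₁ b₂) (q := fun z => h₁ z * h₂ z *
      dslope (dslope Φ (f z₁)) (f z₂) (f z) * ∏ k, (1 - (starRingEnd ℂ) (a k) * z))
    (isOpen_ball (x := (0 : ℂ)) (ε := 1)) (by rintro (k | k) - <;> simp [hb₁, hb₂])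
    ((((hh₁.mul hh₂).mul (hχ.comp hf (Set.mapsTo_image _ _))).mul (by fun_prop)).continuousOn) hP
    (fun z hz => by
      rw [eval_blaschkePolynomial_eq ha hz, hB z hz, hB z₁ hz₁, hΦχ, he₁ z hz, he₂ z hz,
        Fintype.prod_sum_type]
      simp only [Sum.elim_inl, Sum.elim_inr]
      ring)
  have hle := hcard.trans natDegree_blaschkePolynomial_le
  simp only [Finset.card_univ, Fintype.card_sum, Fintype.card_fin] at hle
  omega

/-! ### The factorization -/

theorem mainTheorem3 (n : ℕ) (f : ℂ → ℂ)
    (hf : AnalyticOnNhd ℂ f (Metric.ball (0 : ℂ) 1))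
    (hn : IsExactlyToOneOn n f (Metric.ball (0 : ℂ) 1)) :
    ∃ φ g : ℂ → ℂ, IsFiniteBlaschkeProduct n φ ∧
      AnalyticOnNhd ℂ g (Metric.ball (0 : ℂ) 1) ∧
      Set.InjOn g (Metric.ball (0 : ℂ) 1) ∧
      ∀ z ∈ Metric.ball (0 : ℂ) 1, f z = g (φ z) := by
  have h0 : (0 : ℂ) ∈ ball (0 : ℂ) 1 := mem_ball_self one_pos
  have hfd := hf.differentiableOn
  have hfac : ∀ w ∈ f '' ball 0 1, ∃ a : Fin n → ℂ, FactorsAt f w a :=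
    fun w hw => hn.exists_factorsAt hfd hw
  obtain ⟨a, ha⟩ := hfac _ ⟨0, h0, rfl⟩
  -- The fibre through 0 is nonempty, so it has an index in `Fin n`.
  have hn0 : n ≠ 0 := by
    obtain ⟨k, -⟩ := (ha.eq_iff h0).1 rfl
    exact k.pos.ne'
  have : NeZero n := ⟨hn0⟩
  obtain ⟨Φ, hΦ, hB⟩ := exists_blaschke_eq_comp hn0 hfd hfac ha
  have hBd : DifferentiableOn ℂ (blaschke a) (ball 0 1) :=
    (differentiableOn_blaschke ha.1).mono ball_subset_closedBall
  have hmaps : ∀ z ∈ ball (0 : ℂ) 1, ‖blaschke a z‖ < 1 := fun z hz =>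
    norm_blaschke_lt_one ha.1 (mem_ball_zero_iff.1 hz)
  have hsurj : ∀ u ∈ ball (0 : ℂ) 1, ∃ z ∈ ball (0 : ℂ) 1, blaschke a z = u := by
    intro u hu
    obtain ⟨b, hb⟩ := exists_factorsAt_blaschke ha.1 (mem_ball_zero_iff.1 hu)
    exact ⟨b 0, mem_ball_zero_iff.2 (hb.1 0), hb.apply_eq 0⟩
  have hBfac : ∀ u ∈ blaschke a '' ball 0 1, ∃ b : Fin n → ℂ, FactorsAt (blaschke a) u b := by
    rintro _ ⟨z, hz, rfl⟩
    exact exists_factorsAt_blaschke ha.1 (hmaps z hz)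
  obtain ⟨T, hT, hTsum⟩ := exists_differentiableOn_trace hBd hfd hBfac
  -- All n terms of the trace of f along B are equal to f z.
  have hfT : ∀ z ∈ ball (0 : ℂ) 1, f z = T (blaschke a z) / n := by
    intro z hz
    obtain ⟨b, hb⟩ := hBfac _ ⟨z, hz, rfl⟩
    have hsum : ∀ k, f (b k) = f z := fun k => eq_of_blaschke_eq hn0 hfd hfac ha.1 hΦ hB
      (mem_ball_zero_iff.2 (hb.1 k)) hz (hb.apply_eq k)
    rw [hTsum _ ⟨z, hz, rfl⟩ b hb, Finset.sum_congr rfl fun k _ => hsum k]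
    have : (n : ℂ) ≠ 0 := Nat.cast_ne_zero.2 hn0
    simp [this]
  refine ⟨blaschke a, fun u => T u / n, ⟨1, a, norm_one, ha.1, fun z _ => ?_⟩, ?_, ?_, hfT⟩
  · rw [one_mul, blaschke]
  · refine DifferentiableOn.analyticOnNhd (DifferentiableOn.div_const (hT.mono fun u hu => ?_) _)
      isOpen_ball
    exact hsurj u hu
  -- Φ is a left inverse of g on the disk, because B = Φ ∘ f and B is onto.
  · intro u₁ hu₁ u₂ hu₂ h
    obtain ⟨z₁, hz₁, rfl⟩ := hsurj u₁ hu₁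
    obtain ⟨z₂, hz₂, rfl⟩ := hsurj u₂ hu₂
    simp only [← hfT _ hz₁, ← hfT _ hz₂] at h
    rw [hB z₁ hz₁, hB z₂ hz₂, h]
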